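/- Let $L\ge 3$ and let $N_1,\dots,N_L$ be dimensions. For a tensor $\mathcal A\in\mathbb H^{N_1\times N_2\times N_3\times\cdots\times N_L}$ over the quaternions $\mathbb H$ and $M\in\mathbb H^{N_n\times N_n}$, the mode product $\mathcal A\times_n M$ multiplies the mode-$n$ unfolding of $\mathcal A$ from the left by $M$. Let $T_n\in\mathbb H^{N_n\times N_n}$ ($n=3,\dots,L$) be invertible matrices and put $\widehat{\mathcal A}=\mathcal A\times_3T_3\times_4\cdots\times_LT_L$ (mode $3$ first). The inverse of $\mathcal A\mapsto\widehat{\mathcal A}$ is $\mathcal B\mapsto\mathcal B\times_LT_L^{-1}\times\cdots\times_3T_3^{-1}$ (mode $L$ first). The product $\mathcal A\star_{QT}\mathcal B$ is the tensor $\mathcal C$ such that each frontal slice of $\widehat{\mathcal C}$ is the matrix product of the corresponding frontal slices of $\widehat{\mathcal A}$ and $\widehat{\mathcal B}$. The conjugate transpose $\mathcal A^H$ is the tensor for which each frontal slice of $\widehat{\mathcal A^H}$ is the conjugate transpose of the corresponding frontal slice of $\widehat{\mathcal A}$. The identity tensor $\mathcal I$ is the tensor for which all frontal slices of $\widehat{\mathcal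 I}$ are identity matrices, and $\mathcal U$ is unitary if $\mathcal U^H\star_{QT}\mathcal U=\mathcal I=\mathcal U\star_{QT}\mathcal U^H$. A TQt-SVD of $\mathcal A\in\mathbb H^{N_1\times\cdots\times N_L}$ is a factorization $\mathcal A=\mathcal U\star_{QT}\mathcal D\star_{QT}\mathcal V^H$ with unitary tensors $\mathcal U\in\mathbb H^{N_1\times N_1\times N_3\times\cdots\times N_L}$ and $\mathcal V\in\mathbb H^{N_2\times N_2\times N_3\times\cdots\times N_L}$, and with $\mathcal D\in\mathbb H^{N_1\times\cdots\times N_L}$ f-diagonal (its entries lie on the diagonals of its frontal slices), such that in each frontal slice of $\widehat{\mathcal D}$ the diagonal entries are real, nonnegative and nonincreasing. The tensor $\mathcal A$ has TQt-rank $r$ if it has a TQt-SVD in which exactly $r$ of the tubes $\mathcal D(k,k,:,\dots,:)$, $1\le k\le\min(N_1,N_2)$, are nonzero. **Theorem.** Suppose that $T_n=c_nU_n$ for $n=3,\dots,L$, with nonzero real numbers $c_n$ and unitary matrices $U_n\in\mathbb H^{N_n\times N_n}$. Let $\mathcal A=\mathcal U\star_{QT}\mathcal D\star_{QT}\mathcal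 V^H$ be a TQt-SVD of $\mathcal A\in\mathbb H^{N_1\times\cdots\times N_L}$, let $r$ be the TQt-rank of $\mathcal A$, let $0\le s\le r$, and put $$\mathcal A_s=\sum_{k=1}^{s}\mathcal U(:,k,:,\dots,:)\star_{QT}\mathcal D(k,k,:,\dots,:)\star_{QT}\mathcal V(:,k,:,\dots,:)^H .$$ Then $\mathcal A_s$ has TQt-rank $s$, and it minimizes $\|\mathcal A-\mathcal G\|_F$ over all $\mathcal G\in\mathbb H^{N_1\times\cdots\times N_L}$ of TQt-rank $s$. Moreover, $$\|\mathcal A-\mathcal A_s\|_F^2=\sum_{k=s+1}^{r}\|\mathcal D(k,k,:,\dots,:)\|_F^2 .$$ -/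

import Mathlib

namespace QuatTensor

/-- Quaternion tensors of order `L = d + 2` and size `n₁ × n₂ × N 0 × ⋯ × N (d - 1)`.
The `i`-th entry of `N` is the size of mode `i + 3`. -/
abbrev QTensor {d : ℕ} (n₁ n₂ : ℕ) (N : Fin d → ℕ) : Type :=
  Fin n₁ → Fin n₂ → ((i : Fin d) → Fin (N i)) → Quaternion ℝ

/-- Square invertible quaternion matrices, one for each mode from the third on. -/
abbrev Transforms {d : ℕ} (N : Fin d → ℕ) : Type :=
  (i : Fin d) → (Matrix (Fin (N i)) (Fin (N i)) (Quaternion ℝ))ˣ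

section

variable {d : ℕ} {N : Fin d → ℕ} {n₁ n₂ p : ℕ}

/-- The frontal slice `A(:,:,n₃,…,n_L)`. -/
def slice (A : QTensor n₁ n₂ N) (n : (i : Fin d) → Fin (N i)) :
    Matrix (Fin n₁) (Fin n₂) (Quaternion ℝ) :=
  Matrix.of fun a b => A a b n

/-- The tensor with prescribed frontal slices. -/
def ofSlices (S : ((i : Fin d) → Fin (N i)) → Matrix (Fin n₁) (Fin n₂) (Quaternion ℝ)) :
    QTensor n₁ n₂ N :=
  fun a b n => S n a b

/-- The Frobenius norm. -/
noncomputable def frobNorm (A : QTensor n₁ n₂ N) : ℝ :=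
  Real.sqrt (∑ a, ∑ b, ∑ n, ‖A a b n‖ ^ 2)

/-- The mode product `A ×ᵢ M` along one of the modes from the third on: the corresponding
unfolding of `A` is multiplied by `M` from the left. -/
noncomputable def modeProd (i : Fin d) (M : Matrix (Fin (N i)) (Fin (N i)) (Quaternion ℝ))
    (A : QTensor n₁ n₂ N) : QTensor n₁ n₂ N :=
  fun a b n => ∑ m : Fin (N i), M (n i) m * A a b (Function.update n i m)

/-- `Â = A ×₃ T₃ ×₄ ⋯ ×_L T_L`, the third mode being transformed first. -/
noncomputable def transform (T : Transforms N) (A : QTensor n₁ n₂ N) : QTensor n₁ n₂ N :=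
  (List.finRange d).foldl (fun B i => modeProd i (T i).val B) A

/-- The inverse of `transform`. Mode products of quaternion tensors along different modes need
not commute, so the inverse matrices are applied in the reverse order, the last mode first. -/
noncomputable def invTransform (T : Transforms N) (A : QTensor n₁ n₂ N) : QTensor n₁ n₂ N :=
  (List.finRange d).foldr (fun i B => modeProd i ((T i)⁻¹).val B) A

/-- The facewise product. -/
noncomputable def faceProd (A : QTensor n₁ p N) (B : QTensor p n₂ N) : QTensor n₁ n₂ N :=
  ofSlices fun n => slice A n * slice B n

/-- The transform-based product `A ⋆ B`. -/
noncomputable def qtProd (T : Transforms N) (A : QTensor n₁ p N) (B : QTensor p n₂ N) :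
    QTensor n₁ n₂ N :=
  invTransform T (faceProd (transform T A) (transform T B))

/-- The conjugate transpose `Aᴴ`: in the transform domain, each frontal slice is conjugate
transposed. -/
noncomputable def conjT (T : Transforms N) (A : QTensor n₁ n₂ N) : QTensor n₂ n₁ N :=
  invTransform T (ofSlices fun n => (slice (transform T A) n).conjTranspose)

/-- The identity tensor: in the transform domain, each frontal slice is the identity matrix. -/
noncomputable def identity (T : Transforms N) (p : ℕ) : QTensor p p N :=
  invTransform T (ofSlices fun _ => 1)

/-- Unitary quaternion tensors. -/
def IsUnitary (T : Transforms N) (U : QTensor p p N) : Prop :=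
  qtProd T (conjT T U) U = identity T p ∧ qtProd T U (conjT T U) = identity T p

/-- f-diagonal tensors: the entries lie on the diagonals of the frontal slices. -/
def IsFDiagonal (D : QTensor n₁ n₂ N) : Prop :=
  ∀ a b, a.val ≠ b.val → ∀ n, D a b n = 0

/-- The tube `D(k,k,:,…,:)` as a `1 × 1 × N₃ × ⋯ × N_L` tensor. -/
def tube (D : QTensor n₁ n₂ N) (k : Fin (min n₁ n₂)) : QTensor 1 1 N :=
  fun _ _ n => D (Fin.castLE (min_le_left n₁ n₂) k) (Fin.castLE (min_le_right n₁ n₂) k) n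

/-- The lateral slice `U(:,k,:,…,:)` as an `n₁ × 1 × N₃ × ⋯ × N_L` tensor. -/
def lateral (U : QTensor n₁ n₂ N) (k : Fin n₂) : QTensor n₁ 1 N :=
  fun a _ n => U a k n

/-- `A = U ⋆ D ⋆ Vᴴ` is a TQt-SVD: `U` and `V` are unitary, `D` is f-diagonal, and in the
transform domain each frontal slice is a quaternion matrix singular value decomposition, so that
the diagonal entries of the slices of `D̂` are real, nonnegative and nonincreasing. -/
structure IsTQtSVD (T : Transforms N) (A : QTensor n₁ n₂ N)
    (U : QTensor n₁ n₁ N) (D : QTensor n₁ n₂ N) (V : QTensor n₂ n₂ N) : Prop where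
  unitary_left : IsUnitary T U
  unitary_right : IsUnitary T V
  fdiagonal : IsFDiagonal D
  singularValues : ∃ σ : ((i : Fin d) → Fin (N i)) → Fin (min n₁ n₂) → ℝ,
    (∀ n k, 0 ≤ σ n k) ∧ (∀ n, Antitone (σ n)) ∧
    ∀ n k, transform T D (Fin.castLE (min_le_left n₁ n₂) k)
      (Fin.castLE (min_le_right n₁ n₂) k) n = ((σ n k : ℝ) : Quaternion ℝ)
  eq_prod : A = qtProd T (qtProd T U D) (conjT T V)

/-- The number of nonzero tubes `D(k,k,:,…,:)`. -/
noncomputable def numNonzeroTubes (D : QTensor n₁ n₂ N) : ℕ :=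
  Set.ncard {k : Fin (min n₁ n₂) | 0 < frobNorm (tube D k)}

/-- `A` has TQt-rank `r`: the f-diagonal factor in a TQt-SVD of `A` has `r` nonzero tubes. -/
def HasTQtRank (T : Transforms N) (A : QTensor n₁ n₂ N) (r : ℕ) : Prop :=
  ∃ (U : QTensor n₁ n₁ N) (D : QTensor n₁ n₂ N) (V : QTensor n₂ n₂ N),
    IsTQtSVD T A U D V ∧ numNonzeroTubes D = r

/-- The truncated sum `∑_{k ≤ s} U(:,k,…) ⋆ D(k,k,…) ⋆ V(:,k,…)ᴴ` (indices `k` start at `0`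
here). -/
noncomputable def truncation (T : Transforms N) (U : QTensor n₁ n₁ N) (D : QTensor n₁ n₂ N)
    (V : QTensor n₂ n₂ N) (s : ℕ) : QTensor n₁ n₂ N :=
  ∑ k : Fin (min n₁ n₂) with k.val < s,
    qtProd T (qtProd T (lateral U (Fin.castLE (min_le_left n₁ n₂) k)) (tube D k))
      (conjT T (lateral V (Fin.castLE (min_le_right n₁ n₂) k)))

end

end QuatTensor

open QuatTensor

/-!
In the transform domain a TQt-SVD is a family of singular value decompositions of the frontal
slices, and `A_s` is the facewise truncation of this family, so the Eckart–Young–Mirsky theorem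
for quaternion matrices applies in each slice. For `M = U Σ Vᴴ` and `B = P Σ' Qᴴ` with at most `s`
nonzero singular values, `‖M - B‖ = ‖R Σ - Σ' QᴴV‖` with `R = PᴴU` unitary; the second matrix
has no rows from the `s`-th on, and the first `s` rows of `R Σ` carry the mass `∑ₖ vₖ σₖ²`, where
`vₖ = ∑_{i < s} |Rᵢₖ|²` satisfies `0 ≤ vₖ ≤ 1` and `∑ₖ vₖ ≤ s`, hence at most `∑_{k < s} σₖ²`.
If `Tₙ = cₙ Uₙ`, the transform multiplies the Frobenius norm by `∏ₙ |cₙ|`, which carries the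
result back to the original domain.
-/

namespace QuatTensor

open Matrix Quaternion
open scoped Matrix.Norms.Frobenius

section WeightedSums

variable {R : Type*} [Field R] [LinearOrder R] [IsStrictOrderedRing R]

lemma sum_mul_le_sum_of_threshold {ι : Type*} [Fintype ι] {K : Finset ι} {f v : ι → R} {t : R}
    (ht : 0 ≤ t) (hK : ∀ i ∈ K, t ≤ f i) (hK' : ∀ i ∉ K, f i ≤ t) (hv₀ : ∀ i, 0 ≤ v i)
    (hv₁ : ∀ i, v i ≤ 1) (hv : ∑ i, v i ≤ K.card) : ∑ i, v i * f i ≤ ∑ i ∈ K, f i := by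
  classical
  have key (i : ι) :
      v i * f i - (if i ∈ K then f i else 0) ≤ (v i - if i ∈ K then 1 else 0) * t := by
    split_ifs with hi
    · nlinarith [mul_nonneg (sub_nonneg.2 (hv₁ i)) (sub_nonneg.2 (hK i hi))]
    · simpa using mul_le_mul_of_nonneg_left (hK' i hi) (hv₀ i)
  rw [← sub_nonpos]
  calc ∑ i, v i * f i - ∑ i ∈ K, f i
      = ∑ i, (v i * f i - if i ∈ K then f i else 0) := by simp
    _ ≤ ∑ i, (v i - if i ∈ K then 1 else 0) * t := Finset.sum_le_sum fun i _ => key i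
    _ = (∑ i, v i - K.card) * t := by simp [← Finset.sum_mul]
    _ ≤ 0 := mul_nonpos_of_nonpos_of_nonneg (sub_nonpos.2 hv) ht

lemma sum_mul_le_sum_filter_val_lt {m s : ℕ} {f v : Fin m → R} (hf₀ : ∀ k, 0 ≤ f k)
    (hf : Antitone f) (hv₀ : ∀ k, 0 ≤ v k) (hv₁ : ∀ k, v k ≤ 1) (hv : ∑ k, v k ≤ s) :
    ∑ k, v k * f k ≤ ∑ k with k.val < s, f k := by
  rcases lt_or_ge s m with hsm | hms
  · refine sum_mul_le_sum_of_threshold (hf₀ ⟨s, hsm⟩) (fun k hk => hf ?_) (fun k hk => hf ?_)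
      hv₀ hv₁ ?_
    · exact (Finset.mem_filter.1 hk).2.le
    · simpa [Fin.le_def] using hk
    · rwa [Fin.card_filter_val_lt, min_eq_right hsm.le]
  · rw [Finset.filter_true_of_mem fun k _ => k.isLt.trans_le hms]
    exact Finset.sum_le_sum fun k _ => mul_le_of_le_one_left (hf₀ k) (hv₁ k)

end WeightedSums

lemma mem_iff_lt_ncard_of_isLowerSet {m : ℕ} {S : Set (Fin m)} (hS : IsLowerSet S) (k : Fin m) :
    k ∈ S ↔ k.val < S.ncard := by
  constructor
  · intro hk
    have := Set.ncard_le_ncard (show Set.Iic k ⊆ S from fun j hj => hS hj hk)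
    rw [← Finset.coe_Iic, Set.ncard_coe_finset, Fin.card_Iic] at this
    omega
  · intro hk
    by_contra hkS
    have := Set.ncard_le_ncard
      (show S ⊆ Set.Iio k from fun j hj => lt_of_not_ge fun hkj => hkS (hS hkj hj))
    rw [← Finset.coe_Iio, Set.ncard_coe_finset, Fin.card_Iio] at this
    omega

section Truncate

variable {m : ℕ} {α : Type*} [Zero α]

/-- The sequence `v` with the terms of index at least `s` replaced by zero. -/
def truncate (s : ℕ) (v : Fin m → α) : Fin m → α := fun k => if k.val < s then v k else 0

lemma truncate_of_lt {s : ℕ} {k : Fin m} (hk : k.val < s) (v : Fin m → α) :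
    truncate s v k = v k :=
  if_pos hk

lemma truncate_of_ge {s : ℕ} {k : Fin m} (hk : s ≤ k.val) (v : Fin m → α) :
    truncate s v k = 0 :=
  if_neg hk.not_gt

variable [Preorder α]

lemma truncate_nonneg (s : ℕ) {v : Fin m → α} (hv : ∀ k, 0 ≤ v k) (k : Fin m) :
    0 ≤ truncate s v k := by
  unfold truncate
  split_ifs
  exacts [hv k, le_rfl]

lemma truncate_antitone (s : ℕ) {v : Fin m → α} (hv₀ : ∀ k, 0 ≤ v k) (hv : Antitone v) :
    Antitone (truncate s v) := by
  intro k l hkl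
  rcases lt_or_ge l.val s with hl | hl
  · rw [truncate_of_lt hl, truncate_of_lt (lt_of_le_of_lt hkl hl)]
    exact hv hkl
  · rw [truncate_of_ge hl]
    exact truncate_nonneg s hv₀ k

end Truncate

section FrobeniusNorm

variable {ι κ μ : Type*} [Fintype ι]

lemma coe_sum {α : Type*} (s : Finset α) (f : α → ℝ) :
    ((∑ i ∈ s, f i : ℝ) : ℍ[ℝ]) = ∑ i ∈ s, (f i : ℍ[ℝ]) :=
  map_sum (algebraMap ℝ ℍ[ℝ]) f s

lemma coe_norm_sq (q : ℍ[ℝ]) : ((‖q‖ ^ 2 : ℝ) : ℍ[ℝ]) = star q * q := by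
  rw [star_mul_self, normSq_eq_norm_mul_self, sq]

lemma coe_sum_norm_sq_col (M : Matrix ι κ ℍ[ℝ]) (j : κ) :
    ((∑ i, ‖M i j‖ ^ 2 : ℝ) : ℍ[ℝ]) = (Mᴴ * M) j j := by
  simp only [coe_sum, coe_norm_sq, mul_apply, conjTranspose_apply]

lemma sum_norm_sq_col_eq_one [DecidableEq κ] {R : Matrix ι κ ℍ[ℝ]} (hR : Rᴴ * R = 1) (j : κ) :
    ∑ i, ‖R i j‖ ^ 2 = 1 := by
  rw [← coe_inj, coe_sum_norm_sq_col, hR, one_apply_eq, coe_one]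

lemma sum_norm_sq_row_eq_one [DecidableEq κ] {R : Matrix κ ι ℍ[ℝ]} (hR : R * Rᴴ = 1) (i : κ) :
    ∑ j, ‖R i j‖ ^ 2 = 1 := by
  simpa using sum_norm_sq_col_eq_one (R := Rᴴ) (by simpa using hR) i

variable [Fintype κ]

lemma frobenius_norm_sq {α : Type*} [SeminormedAddCommGroup α] (M : Matrix ι κ α) :
    ‖M‖ ^ 2 = ∑ i, ∑ j, ‖M i j‖ ^ 2 := by
  rw [frobenius_norm_def, ← Real.sqrt_eq_rpow, Real.sq_sqrt (by positivity)]
  simp only [Real.rpow_two]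

lemma coe_frobenius_norm_sq (M : Matrix ι κ ℍ[ℝ]) :
    ((‖M‖ ^ 2 : ℝ) : ℍ[ℝ]) = trace (Mᴴ * M) := by
  rw [frobenius_norm_sq, Finset.sum_comm, coe_sum]
  simp only [coe_sum_norm_sq_col, trace, diag_apply]

variable [Fintype μ]

lemma frobenius_norm_mul_left [DecidableEq ι] {R : Matrix μ ι ℍ[ℝ]} (hR : Rᴴ * R = 1)
    (M : Matrix ι κ ℍ[ℝ]) : ‖R * M‖ = ‖M‖ := by
  rw [← sq_eq_sq₀ (norm_nonneg _) (norm_nonneg _), ← coe_inj, coe_frobenius_norm_sq,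
    coe_frobenius_norm_sq, conjTranspose_mul, Matrix.mul_assoc, ← Matrix.mul_assoc Rᴴ, hR,
    Matrix.one_mul]

lemma frobenius_norm_mul_right [DecidableEq κ] {R : Matrix κ μ ℍ[ℝ]} (hR : R * Rᴴ = 1)
    (M : Matrix ι κ ℍ[ℝ]) : ‖M * R‖ = ‖M‖ := by
  rw [← frobenius_norm_conjTranspose, conjTranspose_mul,
    frobenius_norm_mul_left (by rwa [conjTranspose_conjTranspose]), frobenius_norm_conjTranspose]

end FrobeniusNorm

section RectDiagonal

variable {m n : ℕ}

/-- The row index of the `k`-th diagonal entry of an `m × n` matrix. -/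
abbrev rowIdx (k : Fin (min m n)) : Fin m := Fin.castLE (min_le_left m n) k

/-- The column index of the `k`-th diagonal entry of an `m × n` matrix. -/
abbrev colIdx (k : Fin (min m n)) : Fin n := Fin.castLE (min_le_right m n) k

variable {α : Type*}

/-- The `m × n` matrix with diagonal `v` and zeros elsewhere, the rectangular counterpart of
`Matrix.diagonal`. -/
def rectDiagonal [Zero α] (v : Fin (min m n) → α) : Matrix (Fin m) (Fin n) α :=
  of fun i j => if h : i.val = j.val then v ⟨i.val, lt_min i.isLt (h ▸ j.isLt)⟩ else 0

lemma rectDiagonal_apply_self [Zero α] (v : Fin (min m n) → α) (k : Fin (min m n)) :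
    rectDiagonal v (rowIdx k) (colIdx k) = v k :=
  dif_pos rfl

lemma rectDiagonal_apply_of_ne [Zero α] (v : Fin (min m n) → α) {i : Fin m} {j : Fin n}
    (hij : i.val ≠ j.val) : rectDiagonal v i j = 0 :=
  dif_neg hij

lemma eq_rectDiagonal [Zero α] {M : Matrix (Fin m) (Fin n) α}
    (hM : ∀ i j, i.val ≠ j.val → M i j = 0) :
    M = rectDiagonal fun k => M (rowIdx k) (colIdx k) := by
  ext i j
  by_cases hij : i.val = j.val
  · rw [rectDiagonal, of_apply, dif_pos hij]
    exact congrArg (M i) (Fin.ext hij.symm)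
  · rw [hM i j hij, rectDiagonal_apply_of_ne _ hij]

lemma rectDiagonal_apply_eq_zero [Zero α] {v : Fin (min m n) → α} {s : ℕ}
    (hv : ∀ k, s ≤ k.val → v k = 0) {i : Fin m} (hi : s ≤ i.val) (j : Fin n) :
    rectDiagonal v i j = 0 := by
  by_cases hij : i.val = j.val
  · exact (dif_pos hij).trans (hv _ hi)
  · exact rectDiagonal_apply_of_ne v hij

lemma rectDiagonal_sub [AddGroup α] (v w : Fin (min m n) → α) :
    rectDiagonal v - rectDiagonal w = rectDiagonal (v - w) := by
  ext i j
  by_cases hij : i.val = j.val <;> simp [rectDiagonal, hij]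

lemma mul_rectDiagonal_apply [NonUnitalNonAssocSemiring α] {ι : Type*} (X : Matrix ι (Fin m) α)
    (v : Fin (min m n) → α) (i : ι) (k : Fin (min m n)) :
    (X * rectDiagonal v) i (colIdx k) = X i (rowIdx k) * v k := by
  rw [mul_apply, Finset.sum_eq_single_of_mem (rowIdx k) (Finset.mem_univ _),
    rectDiagonal_apply_self]
  intro a _ ha
  rw [rectDiagonal_apply_of_ne v fun h => ha (Fin.ext h), mul_zero]

lemma mul_rectDiagonal_apply_eq_zero [NonUnitalNonAssocSemiring α] {ι : Type*}
    (X : Matrix ι (Fin m) α) (v : Fin (min m n) → α) (i : ι) {j : Fin n}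
    (hj : j ∉ Set.range (colIdx : Fin (min m n) → Fin n)) : (X * rectDiagonal v) i j = 0 := by
  rw [mul_apply]
  refine Finset.sum_eq_zero fun a _ => ?_
  rw [rectDiagonal_apply_of_ne v, mul_zero]
  exact fun h => hj ⟨⟨j.val, lt_min (h ▸ a.isLt) j.isLt⟩, rfl⟩

lemma mul_rectDiagonal_mul_apply [NonUnitalNonAssocSemiring α] {ι κ : Type*}
    (X : Matrix ι (Fin m) α) (v : Fin (min m n) → α) (Y : Matrix (Fin n) κ α) (i : ι) (j : κ) :
    (X * rectDiagonal v * Y) i j = ∑ k, X i (rowIdx k) * v k * Y (colIdx k) j := by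
  rw [mul_apply]
  refine (Fintype.sum_of_injective colIdx (Fin.castLE_injective _) _ _ (fun l hl => ?_)
    fun k => ?_).symm
  · rw [mul_rectDiagonal_apply_eq_zero X v i hl, zero_mul]
  · rw [mul_rectDiagonal_apply]

lemma sum_norm_sq_mul_rectDiagonal [NonUnitalSeminormedRing α] [NormMulClass α] {ι : Type*}
    (X : Matrix ι (Fin m) α) (v : Fin (min m n) → α) (i : ι) :
    ∑ j, ‖(X * rectDiagonal v) i j‖ ^ 2 = ∑ k, ‖X i (rowIdx k)‖ ^ 2 * ‖v k‖ ^ 2 := by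
  refine (Fintype.sum_of_injective colIdx (Fin.castLE_injective _) _ _ (fun l hl => ?_)
    fun k => ?_).symm
  · rw [mul_rectDiagonal_apply_eq_zero X v i hl, norm_zero, zero_pow two_ne_zero]
  · rw [mul_rectDiagonal_apply, norm_mul, mul_pow]

end RectDiagonal

section EckartYoung

variable {m n : ℕ} {σ τ : Fin (min m n) → ℝ}

lemma frobenius_norm_sq_rectDiagonal_coe :
    ‖(rectDiagonal fun k => (σ k : ℍ[ℝ]) : Matrix (Fin m) (Fin n) ℍ[ℝ])‖ ^ 2 = ∑ k, σ k ^ 2 := by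
  have col_sum (j : Fin m) : ∑ i, ‖(1 : Matrix (Fin m) (Fin m) ℍ[ℝ]) i j‖ ^ 2 = 1 :=
    sum_norm_sq_col_eq_one (by simp) j
  rw [← Matrix.one_mul (rectDiagonal _), frobenius_norm_sq]
  simp only [sum_norm_sq_mul_rectDiagonal, norm_coe, Real.norm_eq_abs, sq_abs]
  rw [Finset.sum_comm]
  simp only [← Finset.sum_mul, col_sum, one_mul]

lemma sum_upper_rows_mul_rectDiagonal_le {R : Matrix (Fin m) (Fin m) ℍ[ℝ]}
    (hR : R ∈ unitary (Matrix (Fin m) (Fin m) ℍ[ℝ])) (hσ₀ : ∀ k, 0 ≤ σ k) (hσ : Antitone σ)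
    (s : ℕ) :
    ∑ i with i.val < s, ∑ j : Fin n, ‖(R * rectDiagonal fun k => (σ k : ℍ[ℝ])) i j‖ ^ 2 ≤
      ∑ k with k.val < s, σ k ^ 2 := by
  have row_mass (i : Fin m) : ∑ k : Fin (min m n), ‖R i (rowIdx k)‖ ^ 2 ≤ 1 := by
    calc _ = ∑ a ∈ Finset.univ.map (Fin.castLEEmb (min_le_left m n)), ‖R i a‖ ^ 2 :=
          (Finset.sum_map _ _ _).symm
      _ ≤ ∑ a, ‖R i a‖ ^ 2 := Finset.sum_le_univ_sum_of_nonneg fun a => by positivity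
      _ = 1 := sum_norm_sq_row_eq_one hR.2 i
  calc _ = ∑ k, (∑ i with i.val < s, ‖R i (rowIdx k)‖ ^ 2) * σ k ^ 2 := by
        simp only [sum_norm_sq_mul_rectDiagonal, norm_coe, Real.norm_eq_abs, sq_abs,
          Finset.sum_mul]
        exact Finset.sum_comm
    _ ≤ ∑ k with k.val < s, σ k ^ 2 := by
        refine sum_mul_le_sum_filter_val_lt (fun k => sq_nonneg _)
          (fun k l hkl => pow_le_pow_left₀ (hσ₀ l) (hσ hkl) 2) (fun k => by positivity)
          (fun k => ?_) ?_
        · rw [← sum_norm_sq_col_eq_one hR.1 (rowIdx k)]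
          exact Finset.sum_le_sum_of_subset_of_nonneg (Finset.filter_subset _ _)
            fun _ _ _ => by positivity
        · rw [Finset.sum_comm]
          refine (Finset.sum_le_card_nsmul _ _ 1 fun i _ => row_mass i).trans ?_
          rw [nsmul_one, Fin.card_filter_val_lt, Nat.cast_le]
          exact min_le_right m s

lemma sum_sq_le_norm_mul_rectDiagonal_sub_sq {R : Matrix (Fin m) (Fin m) ℍ[ℝ]}
    (hR : R ∈ unitary (Matrix (Fin m) (Fin m) ℍ[ℝ])) (hσ₀ : ∀ k, 0 ≤ σ k) (hσ : Antitone σ)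
    {Y : Matrix (Fin m) (Fin n) ℍ[ℝ]} {s : ℕ} (hY : ∀ i, s ≤ i.val → ∀ j, Y i j = 0) :
    ∑ k with s ≤ k.val, σ k ^ 2 ≤ ‖R * (rectDiagonal fun k => (σ k : ℍ[ℝ])) - Y‖ ^ 2 := by
  set X : Matrix (Fin m) (Fin n) ℍ[ℝ] := R * rectDiagonal fun k => (σ k : ℍ[ℝ])
  have upper : ∑ i with i.val < s, ∑ j, ‖X i j‖ ^ 2 ≤ ∑ k with k.val < s, σ k ^ 2 :=
    sum_upper_rows_mul_rectDiagonal_le hR hσ₀ hσ s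
  have total : ∑ i, ∑ j, ‖X i j‖ ^ 2 = ∑ k, σ k ^ 2 := by
    rw [← frobenius_norm_sq, frobenius_norm_mul_left hR.1, frobenius_norm_sq_rectDiagonal_coe]
  rw [← Finset.sum_filter_add_sum_filter_not _ (fun i => i.val < s),
    ← Finset.sum_filter_add_sum_filter_not _ (fun k => k.val < s) fun k => σ k ^ 2] at total
  simp only [not_lt] at total
  calc ∑ k with s ≤ k.val, σ k ^ 2 ≤ ∑ i with s ≤ i.val, ∑ j, ‖X i j‖ ^ 2 := by linarith
    _ = ∑ i with s ≤ i.val, ∑ j, ‖(X - Y) i j‖ ^ 2 := by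
        refine Finset.sum_congr rfl fun i hi => Finset.sum_congr rfl fun j _ => ?_
        rw [Matrix.sub_apply, hY i (Finset.mem_filter.1 hi).2, sub_zero]
    _ ≤ ∑ i, ∑ j, ‖(X - Y) i j‖ ^ 2 :=
        Finset.sum_le_sum_of_subset_of_nonneg (Finset.filter_subset _ _)
          fun _ _ _ => by positivity
    _ = ‖X - Y‖ ^ 2 := (frobenius_norm_sq _).symm

/-- A singular value decomposition `M = U Σ Vᴴ` of a quaternion matrix; the diagonal `σ` of `Σ` is
given as a real sequence. -/
structure IsSVD (M : Matrix (Fin m) (Fin n) ℍ[ℝ]) (U : Matrix (Fin m) (Fin m) ℍ[ℝ])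
    (σ : Fin (min m n) → ℝ) (V : Matrix (Fin n) (Fin n) ℍ[ℝ]) : Prop where
  left_mem : U ∈ unitary (Matrix (Fin m) (Fin m) ℍ[ℝ])
  right_mem : V ∈ unitary (Matrix (Fin n) (Fin n) ℍ[ℝ])
  nonneg : ∀ k, 0 ≤ σ k
  antitone : Antitone σ
  eq_mul : M = U * (rectDiagonal fun k => (σ k : ℍ[ℝ])) * Vᴴ

namespace IsSVD

variable {M B : Matrix (Fin m) (Fin n) ℍ[ℝ]} {U P : Matrix (Fin m) (Fin m) ℍ[ℝ]}
  {V Q : Matrix (Fin n) (Fin n) ℍ[ℝ]}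

lemma sum_sq_le_norm_sub_sq (hM : IsSVD M U σ V) (hB : IsSVD B P τ Q) {s : ℕ}
    (hτ : ∀ k, s ≤ k.val → τ k = 0) : ∑ k with s ≤ k.val, σ k ^ 2 ≤ ‖M - B‖ ^ 2 := by
  have rotate : Pᴴ * (M - B) * V = Pᴴ * U * (rectDiagonal fun k => (σ k : ℍ[ℝ])) -
      (rectDiagonal fun k => (τ k : ℍ[ℝ])) * (Qᴴ * V) := by
    have hV : Vᴴ * V = 1 := hM.right_mem.1
    have hP : Pᴴ * P = 1 := hB.left_mem.1
    rw [hM.eq_mul, hB.eq_mul, Matrix.mul_sub, Matrix.sub_mul]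
    simp only [Matrix.mul_assoc, hV, Matrix.mul_one]
    simp only [← Matrix.mul_assoc, hP, Matrix.one_mul]
  have hPP : Pᴴᴴ * Pᴴ = 1 := by
    rw [conjTranspose_conjTranspose]
    exact hB.left_mem.2
  rw [← frobenius_norm_mul_left hPP, ← frobenius_norm_mul_right hM.right_mem.2, rotate]
  refine sum_sq_le_norm_mul_rectDiagonal_sub_sq
    (mul_mem (Unitary.star_mem hB.left_mem) hM.left_mem) hM.nonneg hM.antitone fun i hi j => ?_
  rw [mul_apply]
  refine Finset.sum_eq_zero fun l _ => ?_
  rw [rectDiagonal_apply_eq_zero (fun k hk => by rw [hτ k hk, coe_zero]) hi, zero_mul]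

lemma norm_sub_sq_of_truncate {s : ℕ} (hM : IsSVD M U σ V) (hB : IsSVD B U (truncate s σ) V) :
    ‖M - B‖ ^ 2 = ∑ k with s ≤ k.val, σ k ^ 2 := by
  have hV : Vᴴᴴ = V := conjTranspose_conjTranspose V
  have tail (k : Fin (min m n)) :
      (σ k - truncate s σ k) ^ 2 = if s ≤ k.val then σ k ^ 2 else 0 := by
    split_ifs with hk
    · rw [truncate_of_ge hk, sub_zero]
    · rw [truncate_of_lt (not_le.1 hk), sub_self, zero_pow two_ne_zero]
  have diff : M - B = U * (rectDiagonal fun k => ((σ k - truncate s σ k : ℝ) : ℍ[ℝ])) * Vᴴ := by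
    rw [hM.eq_mul, hB.eq_mul, ← Matrix.sub_mul, ← Matrix.mul_sub, rectDiagonal_sub]
    simp only [coe_sub]
    rfl
  rw [diff, frobenius_norm_mul_right (by rw [hV]; exact hM.right_mem.1),
    frobenius_norm_mul_left hM.left_mem.1, frobenius_norm_sq_rectDiagonal_coe, Finset.sum_filter]
  exact Finset.sum_congr rfl fun k _ => tail k

end IsSVD

end EckartYoung

variable {d : ℕ} {N : Fin d → ℕ} {n₁ n₂ p : ℕ}

section FrobNorm

lemma frobNorm_nonneg (A : QTensor n₁ n₂ N) : 0 ≤ frobNorm A := Real.sqrt_nonneg _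

lemma frobNorm_sq (A : QTensor n₁ n₂ N) : frobNorm A ^ 2 = ∑ a, ∑ b, ∑ n, ‖A a b n‖ ^ 2 :=
  Real.sq_sqrt (by positivity)

lemma frobNorm_eq_zero {A : QTensor n₁ n₂ N} : frobNorm A = 0 ↔ A = 0 := by
  rw [← sq_eq_zero_iff, frobNorm_sq,
    Fintype.sum_eq_zero_iff_of_nonneg fun a => by dsimp; positivity]
  simp only [funext_iff, Pi.zero_apply]
  refine forall_congr' fun a => ?_
  rw [Fintype.sum_eq_zero_iff_of_nonneg fun b => by dsimp; positivity]
  simp only [funext_iff, Pi.zero_apply]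
  refine forall_congr' fun b => ?_
  rw [Fintype.sum_eq_zero_iff_of_nonneg fun n => by dsimp; positivity]
  simp only [funext_iff, Pi.zero_apply, sq_eq_zero_iff, norm_eq_zero]

lemma frobNorm_sq_eq_sum_slice (A : QTensor n₁ n₂ N) :
    frobNorm A ^ 2 = ∑ n, ‖slice A n‖ ^ 2 := by
  simp only [frobNorm_sq, frobenius_norm_sq, slice, of_apply]
  rw [Finset.sum_comm (s := (Finset.univ : Finset ((i : Fin d) → Fin (N i))))]
  exact Finset.sum_congr rfl fun a _ => Finset.sum_comm

end FrobNorm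

section Unfolding

/-- The unfolding of a tensor along one of the modes from the third on, whose columns are indexed
by the remaining indices. -/
def unfolding (i : Fin d) (A : QTensor n₁ n₂ N) :
    Matrix (Fin (N i)) (Fin n₁ × Fin n₂ × ((j : {j // j ≠ i}) → Fin (N j))) ℍ[ℝ] :=
  of fun m x => A x.1 x.2.1 ((Equiv.piSplitAt i fun j => Fin (N j)).symm (m, x.2.2))

lemma unfolding_injective (i : Fin d) :
    Function.Injective (unfolding i : QTensor n₁ n₂ N → _) := by
  intro A B h
  funext a b n
  simpa only [unfolding, of_apply, Prod.mk.eta, Equiv.symm_apply_apply] using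
    congrFun (congrFun h (Equiv.piSplitAt i _ n).1) (a, b, (Equiv.piSplitAt i _ n).2)

lemma unfolding_add (i : Fin d) (A B : QTensor n₁ n₂ N) :
    unfolding i (A + B) = unfolding i A + unfolding i B :=
  rfl

lemma unfolding_modeProd (i : Fin d) (M : Matrix (Fin (N i)) (Fin (N i)) ℍ[ℝ])
    (A : QTensor n₁ n₂ N) : unfolding i (modeProd i M A) = M * unfolding i A := by
  ext1 m ⟨a, b, y⟩
  have update_split (m' : Fin (N i)) :
      Function.update ((Equiv.piSplitAt i fun j => Fin (N j)).symm (m, y)) i m' =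
        (Equiv.piSplitAt i fun j => Fin (N j)).symm (m', y) := by
    funext j
    by_cases h : j = i
    · subst h
      simp
    · simp [h]
  simp only [unfolding, modeProd, of_apply, mul_apply, update_split]
  simp

lemma frobenius_norm_unfolding (i : Fin d) (A : QTensor n₁ n₂ N) :
    ‖unfolding i A‖ = frobNorm A := by
  rw [← sq_eq_sq₀ (norm_nonneg _) (frobNorm_nonneg _), frobenius_norm_sq, frobNorm_sq,
    Finset.sum_comm, Fintype.sum_prod_type]
  simp only [Fintype.sum_prod_type]
  refine Finset.sum_congr rfl fun a _ => Finset.sum_congr rfl fun b _ => ?_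
  rw [← (Equiv.piSplitAt i fun j => Fin (N j)).symm.sum_comp, Fintype.sum_prod_type_right]
  rfl

lemma modeProd_add (i : Fin d) (M : Matrix (Fin (N i)) (Fin (N i)) ℍ[ℝ])
    (A B : QTensor n₁ n₂ N) : modeProd i M (A + B) = modeProd i M A + modeProd i M B :=
  unfolding_injective i <| by
    simp only [unfolding_add, unfolding_modeProd, Matrix.mul_add]

lemma modeProd_modeProd (i : Fin d) (M M' : Matrix (Fin (N i)) (Fin (N i)) ℍ[ℝ])
    (A : QTensor n₁ n₂ N) : modeProd i M (modeProd i M' A) = modeProd i (M * M') A :=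
  unfolding_injective i <| by simp only [unfolding_modeProd, Matrix.mul_assoc]

lemma modeProd_one (i : Fin d) (A : QTensor n₁ n₂ N) : modeProd i 1 A = A :=
  unfolding_injective i <| by rw [unfolding_modeProd, Matrix.one_mul]

lemma frobNorm_modeProd_smul {i : Fin d} (c : ℝ) {W : Matrix (Fin (N i)) (Fin (N i)) ℍ[ℝ]}
    (hW : Wᴴ * W = 1) (A : QTensor n₁ n₂ N) :
    frobNorm (modeProd i (c • W) A) = |c| * frobNorm A := by
  rw [← frobenius_norm_unfolding i, unfolding_modeProd, Matrix.smul_mul, norm_smul,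
    frobenius_norm_mul_left hW, frobenius_norm_unfolding, Real.norm_eq_abs]

end Unfolding

section Transform

variable (T : Transforms N)

lemma transform_add (A B : QTensor n₁ n₂ N) :
    transform T (A + B) = transform T A + transform T B := by
  unfold transform
  induction List.finRange d generalizing A B with
  | nil => rfl
  | cons i l ih => rw [List.foldl_cons, List.foldl_cons, List.foldl_cons, modeProd_add, ih]

lemma invTransform_transform (A : QTensor n₁ n₂ N) : invTransform T (transform T A) = A := by
  unfold transform invTransform
  induction List.finRange d generalizing A with
  | nil => rfl
  | cons i l ih =>
    rw [List.foldl_cons, List.foldr_cons, ih, modeProd_modeProd, Units.inv_mul, modeProd_one]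

lemma transform_invTransform (A : QTensor n₁ n₂ N) : transform T (invTransform T A) = A := by
  unfold transform invTransform
  induction List.finRange d with
  | nil => rfl
  | cons i l ih =>
    rw [List.foldl_cons, List.foldr_cons, modeProd_modeProd, Units.mul_inv, modeProd_one, ih]

/-- The transform as an additive isomorphism, which makes the `map_` lemmas available. -/
noncomputable def transformEquiv : QTensor n₁ n₂ N ≃+ QTensor n₁ n₂ N where
  toFun := transform T
  invFun := invTransform T
  left_inv := invTransform_transform T
  right_inv := transform_invTransform T
  map_add' := transform_add T

lemma transform_injective :
    Function.Injective (transform T : QTensor n₁ n₂ N → QTensor n₁ n₂ N) :=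
  (transformEquiv T).injective

lemma transform_eq_zero_iff {A : QTensor n₁ n₂ N} : transform T A = 0 ↔ A = 0 :=
  (transformEquiv T).map_eq_zero_iff

lemma transform_sub (A B : QTensor n₁ n₂ N) :
    transform T (A - B) = transform T A - transform T B :=
  map_sub (transformEquiv T) A B

lemma transform_sum {ι : Type*} (s : Finset ι) (A : ι → QTensor n₁ n₂ N) :
    transform T (∑ k ∈ s, A k) = ∑ k ∈ s, transform T (A k) :=
  map_sum (transformEquiv T) A s

lemma transform_apply_congr {m₁ m₂ : ℕ} {A : QTensor n₁ n₂ N} {B : QTensor m₁ m₂ N} {a : Fin n₁}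
    {b : Fin n₂} {a' : Fin m₁} {b' : Fin m₂} (h : A a b = B a' b') :
    transform T A a b = transform T B a' b' := by
  unfold transform
  induction List.finRange d generalizing A B with
  | nil => exact h
  | cons i l ih =>
    rw [List.foldl_cons, List.foldl_cons]
    refine ih ?_
    funext n
    simp only [modeProd, h]

lemma transform_apply_eq_zero {A : QTensor n₁ n₂ N} {a : Fin n₁} {b : Fin n₂} (h : A a b = 0) :
    transform T A a b = 0 := by
  rw [transform_apply_congr T (B := (0 : QTensor n₁ n₂ N)) (a' := a) (b' := b) h,
    (transform_eq_zero_iff T).2 rfl]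
  rfl

lemma transform_tube_apply (D : QTensor n₁ n₂ N) (k : Fin (min n₁ n₂)) (a b : Fin 1) :
    transform T (tube D k) a b = transform T D (rowIdx k) (colIdx k) :=
  transform_apply_congr T rfl

lemma transform_lateral_apply (U : QTensor n₁ n₂ N) (k : Fin n₂) (a : Fin n₁) (b : Fin 1) :
    transform T (lateral U k) a b = transform T U a k :=
  transform_apply_congr T rfl

lemma frobNorm_transform {T : Transforms N} {c : Fin d → ℝ}
    {W : (i : Fin d) → Matrix (Fin (N i)) (Fin (N i)) ℍ[ℝ]} (hW : ∀ i, (W i)ᴴ * W i = 1)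
    (hT : ∀ i, (T i).val = c i • W i) (A : QTensor n₁ n₂ N) :
    frobNorm (transform T A) = |∏ i, c i| * frobNorm A := by
  rw [Fin.prod_univ_def]
  unfold transform
  induction List.finRange d generalizing A with
  | nil => simp
  | cons i l ih =>
    rw [List.foldl_cons, ih, hT, frobNorm_modeProd_smul _ (hW i), List.map_cons, List.prod_cons,
      abs_mul, mul_left_comm, mul_assoc]

variable (n : (i : Fin d) → Fin (N i))

lemma slice_transform_qtProd (A : QTensor n₁ p N) (B : QTensor p n₂ N) :
    slice (transform T (qtProd T A B)) n = slice (transform T A) n * slice (transform T B) n := by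
  rw [qtProd, transform_invTransform]
  rfl

lemma slice_transform_conjT (A : QTensor n₁ n₂ N) :
    slice (transform T (conjT T A)) n = (slice (transform T A) n)ᴴ := by
  rw [conjT, transform_invTransform]
  rfl

lemma slice_transform_identity : slice (transform T (identity T p)) n = 1 := by
  rw [identity, transform_invTransform]
  rfl

lemma slice_transform_qtProd_conjT {q : ℕ} (U : QTensor n₁ p N) (D : QTensor p q N)
    (V : QTensor n₂ q N) :
    slice (transform T (qtProd T (qtProd T U D) (conjT T V))) n =
      slice (transform T U) n * slice (transform T D) n * (slice (transform T V) n)ᴴ := by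
  rw [slice_transform_qtProd, slice_transform_qtProd, slice_transform_conjT]

variable {T}

lemma IsUnitary.slice_transform_mem {U : QTensor p p N} (hU : IsUnitary T U) :
    slice (transform T U) n ∈ unitary (Matrix (Fin p) (Fin p) ℍ[ℝ]) := by
  rw [Unitary.mem_iff, star_eq_conjTranspose, ← slice_transform_conjT, ← slice_transform_qtProd,
    ← slice_transform_qtProd, hU.1, hU.2]
  exact ⟨slice_transform_identity T n, slice_transform_identity T n⟩

lemma IsFDiagonal.slice_transform {D : QTensor n₁ n₂ N} (hD : IsFDiagonal D) :
    slice (transform T D) n = rectDiagonal fun k => transform T D (rowIdx k) (colIdx k) n :=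
  eq_rectDiagonal fun a b hab =>
    congrFun (transform_apply_eq_zero T (funext (hD a b hab))) n

end Transform

section TruncateRows

/-- The tensor `D` with the rows from `s` on replaced by zero, which is the f-diagonal factor of
the truncation of a TQt-SVD with f-diagonal factor `D`. -/
noncomputable def truncateRows (s : ℕ) (D : QTensor n₁ n₂ N) : QTensor n₁ n₂ N :=
  fun a b n => if a.val < s then D a b n else 0

lemma IsFDiagonal.truncateRows {D : QTensor n₁ n₂ N} (hD : IsFDiagonal D) (s : ℕ) :
    IsFDiagonal (truncateRows s D) := by
  intro a b hab n
  simp [QuatTensor.truncateRows, hD a b hab n]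

lemma tube_truncateRows (s : ℕ) (D : QTensor n₁ n₂ N) :
    tube (truncateRows s D) = truncate s (tube D) := by
  funext k a b n
  by_cases hk : k.val < s <;> simp [tube, truncateRows, truncate, hk]

variable (T : Transforms N)

lemma transform_truncateRows (s : ℕ) (D : QTensor n₁ n₂ N) :
    transform T (truncateRows s D) = truncateRows s (transform T D) := by
  funext a b n
  by_cases ha : a.val < s
  · have row_eq : truncateRows s D a b = D a b := funext fun _ => if_pos ha
    rw [transform_apply_congr T row_eq, truncateRows, if_pos ha]
  · have row_eq : truncateRows s D a b = 0 := funext fun _ => if_neg ha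
    rw [transform_apply_eq_zero T row_eq, truncateRows, if_neg ha, Pi.zero_apply]

lemma truncation_eq_qtProd_truncateRows (U : QTensor n₁ n₁ N) {D : QTensor n₁ n₂ N}
    (hD : IsFDiagonal D) (V : QTensor n₂ n₂ N) (s : ℕ) :
    truncation T U D V s = qtProd T (qtProd T U (truncateRows s D)) (conjT T V) := by
  apply transform_injective T
  funext a b n
  have summand (k : Fin (min n₁ n₂)) :
      transform T (qtProd T (qtProd T (lateral U (rowIdx k)) (tube D k))
        (conjT T (lateral V (colIdx k)))) a b n =
      transform T U a (rowIdx k) n * transform T D (rowIdx k) (colIdx k) n *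
        star (transform T V b (colIdx k) n) := by
    have := congrFun (congrFun (slice_transform_qtProd_conjT T n (lateral U (rowIdx k)) (tube D k)
      (lateral V (colIdx k))) a) b
    simpa [slice, mul_apply, transform_tube_apply, transform_lateral_apply] using this
  have product := congrFun (congrFun
    (slice_transform_qtProd_conjT T n U (truncateRows s D) V) a) b
  rw [(hD.truncateRows s).slice_transform, mul_rectDiagonal_mul_apply] at product
  refine Eq.trans ?_ product.symm
  rw [truncation, transform_sum, Finset.sum_apply, Finset.sum_apply, Finset.sum_apply,
    Finset.sum_filter]
  refine Finset.sum_congr rfl fun k _ => ?_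
  rw [transform_truncateRows, summand]
  by_cases hk : k.val < s <;> simp [truncateRows, slice, hk]

end TruncateRows

section TQtSVD

variable {T : Transforms N}

/-- The diagonal of the `n`-th frontal slice of `D̂`, as a sequence of real numbers; the imaginary
parts are dropped, and they vanish if `D` is the f-diagonal factor of a TQt-SVD. -/
noncomputable def sliceSingularValues (T : Transforms N) (D : QTensor n₁ n₂ N)
    (n : (i : Fin d) → Fin (N i)) (k : Fin (min n₁ n₂)) : ℝ :=
  (transform T D (rowIdx k) (colIdx k) n).re

lemma sliceSingularValues_truncateRows (s : ℕ) (D : QTensor n₁ n₂ N)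
    (n : (i : Fin d) → Fin (N i)) :
    sliceSingularValues T (truncateRows s D) n = truncate s (sliceSingularValues T D n) := by
  funext k
  by_cases hk : k.val < s <;>
    simp [sliceSingularValues, transform_truncateRows, truncateRows, truncate, hk]

lemma numNonzeroTubes_le_min (D : QTensor n₁ n₂ N) : numNonzeroTubes D ≤ min n₁ n₂ :=
  (Set.ncard_le_card _).trans_eq (Nat.card_fin _)

namespace IsTQtSVD

variable {A G : QTensor n₁ n₂ N} {U P : QTensor n₁ n₁ N} {D E : QTensor n₁ n₂ N}
  {V Q : QTensor n₂ n₂ N}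

lemma coe_sliceSingularValues (h : IsTQtSVD T A U D V) (n : (i : Fin d) → Fin (N i))
    (k : Fin (min n₁ n₂)) :
    (sliceSingularValues T D n k : ℍ[ℝ]) = transform T D (rowIdx k) (colIdx k) n := by
  obtain ⟨σ, -, -, hσ⟩ := h.singularValues
  rw [sliceSingularValues, hσ, re_coe]

lemma sliceSingularValues_nonneg (h : IsTQtSVD T A U D V) (n : (i : Fin d) → Fin (N i))
    (k : Fin (min n₁ n₂)) : 0 ≤ sliceSingularValues T D n k := by
  obtain ⟨σ, hσ₀, -, hσ⟩ := h.singularValues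
  rw [sliceSingularValues, hσ, re_coe]
  exact hσ₀ n k

lemma sliceSingularValues_antitone (h : IsTQtSVD T A U D V) (n : (i : Fin d) → Fin (N i)) :
    Antitone (sliceSingularValues T D n) := by
  obtain ⟨σ, -, hσ_anti, hσ⟩ := h.singularValues
  intro k l hkl
  simpa only [sliceSingularValues, hσ, re_coe] using hσ_anti n hkl

lemma isSVD_slice (h : IsTQtSVD T A U D V) (n : (i : Fin d) → Fin (N i)) :
    IsSVD (slice (transform T A) n) (slice (transform T U) n) (sliceSingularValues T D n)
      (slice (transform T V) n) where
  left_mem := h.unitary_left.slice_transform_mem n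
  right_mem := h.unitary_right.slice_transform_mem n
  nonneg := h.sliceSingularValues_nonneg n
  antitone := h.sliceSingularValues_antitone n
  eq_mul := by
    simp only [h.coe_sliceSingularValues, ← h.fdiagonal.slice_transform]
    exact (congrArg (fun B => slice (transform T B) n) h.eq_prod).trans
      (slice_transform_qtProd_conjT T n U D V)

lemma truncation (h : IsTQtSVD T A U D V) (s : ℕ) :
    IsTQtSVD T (truncation T U D V s) U (truncateRows s D) V where
  unitary_left := h.unitary_left
  unitary_right := h.unitary_right
  fdiagonal := h.fdiagonal.truncateRows s
  singularValues := by
    refine ⟨fun n => truncate s (sliceSingularValues T D n),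
      fun n => truncate_nonneg s (h.sliceSingularValues_nonneg n),
      fun n => truncate_antitone s (h.sliceSingularValues_nonneg n)
        (h.sliceSingularValues_antitone n), fun n k => ?_⟩
    rw [transform_truncateRows]
    dsimp only
    by_cases hk : k.val < s
    · rw [truncate_of_lt hk, h.coe_sliceSingularValues]
      exact if_pos hk
    · rw [truncate_of_ge (not_lt.1 hk), coe_zero]
      exact if_neg hk
  eq_prod := truncation_eq_qtProd_truncateRows T U h.fdiagonal V s

lemma tube_eq_zero_iff (h : IsTQtSVD T A U D V) {k : Fin (min n₁ n₂)} :
    tube D k = 0 ↔ ∀ n, sliceSingularValues T D n k = 0 := by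
  rw [← transform_eq_zero_iff T]
  simp only [funext_iff, Fin.forall_fin_one, transform_tube_apply, ← h.coe_sliceSingularValues,
    Pi.zero_apply]
  exact forall_congr' fun n => coe_inj

lemma frobNorm_sq_transform_tube (h : IsTQtSVD T A U D V) (k : Fin (min n₁ n₂)) :
    frobNorm (transform T (tube D k)) ^ 2 = ∑ n, sliceSingularValues T D n k ^ 2 := by
  simp [frobNorm_sq, transform_tube_apply, ← h.coe_sliceSingularValues]

lemma tube_ne_zero_iff (h : IsTQtSVD T A U D V) {k : Fin (min n₁ n₂)} :
    tube D k ≠ 0 ↔ k.val < numNonzeroTubes D := by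
  have mem_iff (k : Fin (min n₁ n₂)) : 0 < frobNorm (tube D k) ↔ tube D k ≠ 0 :=
    (frobNorm_nonneg _).lt_iff_ne'.trans frobNorm_eq_zero.not
  have lower : IsLowerSet {k : Fin (min n₁ n₂) | 0 < frobNorm (tube D k)} := by
    intro k l hlk hk
    rw [Set.mem_ofPred_eq, mem_iff, Ne, h.tube_eq_zero_iff] at hk ⊢
    exact fun hl => hk fun n =>
      le_antisymm ((h.sliceSingularValues_antitone n hlk).trans_eq (hl n))
        (h.sliceSingularValues_nonneg n k)
  rw [← mem_iff, numNonzeroTubes, ← mem_iff_lt_ncard_of_isLowerSet lower, Set.mem_ofPred_eq]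

lemma sliceSingularValues_eq_zero (h : IsTQtSVD T A U D V) {k : Fin (min n₁ n₂)}
    (hk : numNonzeroTubes D ≤ k.val) (n : (i : Fin d) → Fin (N i)) :
    sliceSingularValues T D n k = 0 :=
  h.tube_eq_zero_iff.1 (not_not.1 fun hne => hk.not_gt (h.tube_ne_zero_iff.1 hne)) n

lemma numNonzeroTubes_le_of_tube_eq_zero (h : IsTQtSVD T A U D V) {t : ℕ}
    (ht : ∀ k : Fin (min n₁ n₂), t ≤ k.val → tube D k = 0) : numNonzeroTubes D ≤ t := by
  by_contra! hlt
  exact (h.tube_ne_zero_iff (k := ⟨t, hlt.trans_le (numNonzeroTubes_le_min D)⟩)).2 hlt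
    (ht _ le_rfl)

lemma frobNorm_sq_transform_sub_truncation (h : IsTQtSVD T A U D V) (s : ℕ) :
    frobNorm (transform T (A - QuatTensor.truncation T U D V s)) ^ 2 =
      ∑ n, ∑ k with s ≤ k.val, sliceSingularValues T D n k ^ 2 := by
  rw [frobNorm_sq_eq_sum_slice, transform_sub]
  refine Finset.sum_congr rfl fun n _ => (h.isSVD_slice n).norm_sub_sq_of_truncate ?_
  rw [← sliceSingularValues_truncateRows]
  exact (h.truncation s).isSVD_slice n

lemma sum_sq_le_frobNorm_sq_transform_sub (hA : IsTQtSVD T A U D V) (hG : IsTQtSVD T G P E Q)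
    {s : ℕ} (hs : numNonzeroTubes E ≤ s) :
    ∑ n, ∑ k with s ≤ k.val, sliceSingularValues T D n k ^ 2 ≤
      frobNorm (transform T (A - G)) ^ 2 := by
  rw [frobNorm_sq_eq_sum_slice, transform_sub]
  exact Finset.sum_le_sum fun n _ => (hA.isSVD_slice n).sum_sq_le_norm_sub_sq (hG.isSVD_slice n)
    fun k hk => hG.sliceSingularValues_eq_zero (hs.trans hk) n

-- The lower bound of Eckart–Young, applied to `A` as an approximation of itself.
lemma numNonzeroTubes_le (h : IsTQtSVD T A U D V) (h' : IsTQtSVD T A P E Q) :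
    numNonzeroTubes D ≤ numNonzeroTubes E := by
  refine h.numNonzeroTubes_le_of_tube_eq_zero fun k hk => h.tube_eq_zero_iff.2 fun n => ?_
  have bound := h.sum_sq_le_frobNorm_sq_transform_sub h' le_rfl
  rw [sub_self, (transform_eq_zero_iff T).2 rfl, frobNorm_eq_zero.2 rfl,
    zero_pow two_ne_zero] at bound
  refine pow_eq_zero_iff two_ne_zero |>.1 (le_antisymm ?_ (sq_nonneg _))
  calc sliceSingularValues T D n k ^ 2
      ≤ ∑ k with numNonzeroTubes E ≤ k.val, sliceSingularValues T D n k ^ 2 :=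
        Finset.single_le_sum (f := fun k => sliceSingularValues T D n k ^ 2)
          (fun _ _ => sq_nonneg _) (Finset.mem_filter.2 ⟨Finset.mem_univ k, hk⟩)
    _ ≤ ∑ n, ∑ k with numNonzeroTubes E ≤ k.val, sliceSingularValues T D n k ^ 2 :=
        Finset.single_le_sum
          (f := fun n => ∑ k with numNonzeroTubes E ≤ k.val, sliceSingularValues T D n k ^ 2)
          (fun _ _ => Finset.sum_nonneg fun _ _ => sq_nonneg _) (Finset.mem_univ n)
    _ ≤ 0 := bound

lemma numNonzeroTubes_eq (h : IsTQtSVD T A U D V) {r : ℕ} (hr : HasTQtRank T A r) :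
    numNonzeroTubes D = r := by
  obtain ⟨P, E, Q, h', rfl⟩ := hr
  exact le_antisymm (h.numNonzeroTubes_le h') (h'.numNonzeroTubes_le h)

lemma numNonzeroTubes_truncateRows (h : IsTQtSVD T A U D V) {s : ℕ}
    (hs : s ≤ numNonzeroTubes D) : numNonzeroTubes (truncateRows s D) = s := by
  have hT := h.truncation s
  refine le_antisymm (hT.numNonzeroTubes_le_of_tube_eq_zero fun k hk => ?_) ?_
  · rw [tube_truncateRows, truncate_of_ge hk]
  · by_contra! hlt
    have tube_ne := (h.tube_ne_zero_iff (k := ⟨numNonzeroTubes (truncateRows s D),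
      (hlt.trans_le hs).trans_le (numNonzeroTubes_le_min D)⟩)).2 (hlt.trans_le hs)
    rw [← truncate_of_lt hlt (tube D), ← tube_truncateRows, hT.tube_ne_zero_iff] at tube_ne
    exact tube_ne.false

end IsTQtSVD

end TQtSVD

end QuatTensor

theorem theorem2_general {d : ℕ} {N : Fin d → ℕ} {n₁ n₂ : ℕ} {T : Transforms N}
    {A : QTensor n₁ n₂ N} {U : QTensor n₁ n₁ N} {D : QTensor n₁ n₂ N} {V : QTensor n₂ n₂ N}
    (hA : IsTQtSVD T A U D V) {r s : ℕ} (hr : HasTQtRank T A r) (hs : s ≤ r) :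
    HasTQtRank T (truncation T U D V s) s ∧
    (∀ G : QTensor n₁ n₂ N, ∀ t ≤ s, HasTQtRank T G t →
      frobNorm (transform T (A - truncation T U D V s)) ≤ frobNorm (transform T (A - G))) ∧
    frobNorm (transform T (A - truncation T U D V s)) ^ 2 =
      ∑ k : Fin (min n₁ n₂) with s ≤ k.val ∧ k.val < r, frobNorm (transform T (tube D k)) ^ 2 := by
  have hDr := hA.numNonzeroTubes_eq hr
  refine ⟨⟨U, _, V, hA.truncation s, hA.numNonzeroTubes_truncateRows (hs.trans_eq hDr.symm)⟩,
    ?_, ?_⟩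
  · rintro G _ ht ⟨P, E, Q, hG, rfl⟩
    rw [← sq_le_sq₀ (frobNorm_nonneg _) (frobNorm_nonneg _),
      hA.frobNorm_sq_transform_sub_truncation]
    exact hA.sum_sq_le_frobNorm_sq_transform_sub hG ht
  · rw [hA.frobNorm_sq_transform_sub_truncation, Finset.sum_comm]
    simp only [← hA.frobNorm_sq_transform_tube, ← Finset.filter_filter]
    refine (Finset.sum_filter_of_ne fun k _ hk => ?_).symm
    rw [← hDr, ← hA.tube_ne_zero_iff]
    exact fun tube_eq => hk (pow_eq_zero_iff two_ne_zero |>.2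
      (frobNorm_eq_zero.2 ((transform_eq_zero_iff T).2 tube_eq)))

theorem theorem2 {d : ℕ} {N : Fin d → ℕ} {n₁ n₂ : ℕ}
    (T : Transforms N) (c : (i : Fin d) → ℝ)
    (W : (i : Fin d) → Matrix (Fin (N i)) (Fin (N i)) (Quaternion ℝ))
    (hc : ∀ i, c i ≠ 0)
    (hW : ∀ i, W i ∈ unitary (Matrix (Fin (N i)) (Fin (N i)) (Quaternion ℝ)))
    (hT : ∀ i, (T i).val = c i • W i)
    (A : QTensor n₁ n₂ N)
    (U : QTensor n₁ n₁ N) (D : QTensor n₁ n₂ N) (V : QTensor n₂ n₂ N)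
    (hA : IsTQtSVD T A U D V)
    (r s : ℕ) (hr : HasTQtRank T A r) (hs : s ≤ r) :
    HasTQtRank T (truncation T U D V s) s ∧
    (∀ G : QTensor n₁ n₂ N, HasTQtRank T G s →
      frobNorm (A - truncation T U D V s) ≤ frobNorm (A - G)) ∧
    frobNorm (A - truncation T U D V s) ^ 2 =
      ∑ k : Fin (min n₁ n₂) with s ≤ k.val ∧ k.val < r, frobNorm (tube D k) ^ 2 := by
  have hC : 0 < |∏ i, c i| := abs_pos.2 (Finset.prod_ne_zero_iff.2 fun i _ => hc i)
  obtain ⟨rank_eq, minimal, error⟩ := theorem2_general hA hr hs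
  simp only [frobNorm_transform (fun i => (hW i).1) hT, mul_pow, ← Finset.mul_sum] at minimal error
  exact ⟨rank_eq, fun G hG => le_of_mul_le_mul_left (minimal G s le_rfl hG) hC,
    mul_left_cancel₀ (pow_pos hC 2).ne' error⟩
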